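/- Let $n\in\mathbb N$ and $\lambda>0$. Let $\mathbb D^n=\{z\in\mathbb C^n:|z_1|,\dots,|z_n|<1\}$ and let $\mathbb A^{(\lambda)}(\mathbb D^n)$ be the weighted Bergman space, i.e. the Hilbert space of functions on $\mathbb D^n$ with reproducing kernel $$K^{(\lambda)}(z,w)=\prod_{j=1}^n(1-z_j\bar w_j)^{-\lambda},$$ regarded, via pointwise multiplication, as a Hilbert module over the ring $\mathbb C[z]^{\mathfrak S_n}=\mathbb C[s_1,\dots,s_n]$ of symmetric polynomials, where $s_k$ is the $k$-th elementary symmetric polynomial. Let $s=(s_1,\dots,s_n):\mathbb C^n\to\mathbb C^n$ be the symmetrization map, $\mathbb G_n=s(\mathbb D^n)$ the symmetrized polydisc, $\mathcal Z=\{z\in\mathbb D^n: z_i=z_j\text{ for some }i\ne j\}$, $\Omega=\mathbb G_n\setminus s(\mathcal Z)$, and write $U^*=\{v:\bar v\in U\}$ for $U\subseteq\mathbb C^n$. For $u\in\Omega$ let $\mathbb C_u$ be the one-dimensional module on which $q(s_1,\dots,s_n)$ acts as the scalar $q(u)$, and let $\mathcal T_u=\mathbb A^{(\lambda)}(\mathbb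 D^n)\otimes_{\mathbb C[z]^{\mathfrak S_n}}\mathbb C_u$ be the module tensor product, realized as the orthogonal complement in $\mathbb A^{(\lambda)}(\mathbb D^n)$ of $\{q(s)f-q(u)f: q\in\mathbb C[u_1,\dots,u_n],\ f\in\mathbb A^{(\lambda)}(\mathbb D^n)\}$. Functions $\gamma_1,\dots,\gamma_k:V\to\mathbb A^{(\lambda)}(\mathbb D^n)$ on an open set $V\subseteq\Omega^*$ are called a holomorphic frame on $V$ if they are holomorphic and, for each $v\in V$, the vectors $\gamma_1(v),\dots,\gamma_k(v)$ are linearly independent with linear span $\mathcal T_{\bar v}$. Then: 1. The module is locally free of rank $n!$ on $\Omega$: $\Omega$ is a bounded, open, connected set, and every point of $\Omega^*$ has an open neighbourhood $V\subseteq\Omega^*$ carrying a holomorphic frame of $n!$ functions. 2. Every point of $\Omega$ has an open neighbourhood $U\subseteq\Omega$ on which $s$ admits $n!$ holomorphic local inverses $\varphi_1,\dots,\varphi_{n!}:U\to\mathbb D^n$, that is, $s\circ\varphi_i=\mathrm{id}_U$ and, for each $u\in U$, the points $\varphi_1(u),\dots,\varphi_{n!}(u)$ are pairwise distinct and are all the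 points of $\mathbb D^n\cap s^{-1}(u)$. 3. For every open $U\subseteq\Omega$ and all such local inverses $\varphi_1,\dots,\varphi_{n!}$ on $U$, the kernel functions $$\gamma_i(v)=K^{(\lambda)}\big(\cdot,\varphi_i(\bar v)\big),\qquad v\in U^*,\ 1\le i\le n!,$$ form a holomorphic frame on $U^*$. -/

import Mathlib

namespace BergmanModule

open scoped ComplexConjugate InnerProductSpace

/-- The open unit polydisc in `ℂⁿ`. -/
def polydisc (n : ℕ) : Set (Fin n → ℂ) := {z | ∀ j, ‖z j‖ < 1}

/-- The kernel `K^(λ)(z, w) = ∏ⱼ (1 - zⱼ conj(wⱼ))^(-λ)` (principal branch), here with `l = λ`. -/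
noncomputable def scalarKernel (n : ℕ) (l : ℝ) (z w : Fin n → ℂ) : ℂ :=
  ∏ j, (1 - z j * conj (w j)) ^ (-(l : ℂ))

/-- Positive semidefiniteness of a scalar kernel on `X`. -/
def IsPSD {X : Type*} (k : X → X → ℂ) : Prop :=
  ∀ (s : Finset X) (c : X → ℂ),
    0 ≤ (∑ x ∈ s, ∑ y ∈ s, conj (c x) * c y * k x y).re

theorem IsPSD.mul_of_hasSum {X : Type*} {k₁ k₂ : X → X → ℂ} (b : ℕ → ℝ) (g : ℕ → X → ℂ)
    (hb : ∀ m, 0 ≤ b m)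
    (h₁ : ∀ x y, HasSum (fun m => (b m : ℂ) * (g m x * conj (g m y))) (k₁ x y))
    (h₂ : IsPSD k₂) : IsPSD (fun x y => k₁ x y * k₂ x y) := by
  intro s c
  have hs : HasSum (fun m => ∑ x ∈ s, ∑ y ∈ s,
      conj (c x) * c y * (((b m : ℂ) * (g m x * conj (g m y))) * k₂ x y))
      (∑ x ∈ s, ∑ y ∈ s, conj (c x) * c y * (k₁ x y * k₂ x y)) :=
    hasSum_sum fun x _ => hasSum_sum fun y _ => ((h₁ x y).mul_right _).mul_left _
  have hre := Complex.hasSum_re hs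
  refine hre.nonneg fun m => ?_
  have := mul_nonneg (hb m) (h₂ s (fun x => c x * conj (g m x)))
  rw [← Complex.re_ofReal_mul, Finset.mul_sum] at this
  convert this using 3 with x _
  rw [Finset.mul_sum]
  refine Finset.sum_congr rfl fun y _ => ?_
  simp only [map_mul, Complex.conj_conj]
  ring

theorem isPSD_one {X : Type*} : IsPSD (fun _ _ : X => (1 : ℂ)) := by
  intro s c
  have : ∑ x ∈ s, ∑ y ∈ s, conj (c x) * c y * (1 : ℂ)
      = conj (∑ x ∈ s, c x) * ∑ x ∈ s, c x := by
    rw [map_sum, Finset.sum_mul_sum]; simp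
  rw [this, mul_comm, Complex.mul_conj]
  exact_mod_cast Complex.normSq_nonneg _

/-- The Taylor coefficients of `(1 - t) ^ (-l)`. -/
noncomputable def binomCoeff (l : ℝ) (m : ℕ) : ℝ := ∏ i ∈ Finset.range m, ((l + i) / (i + 1))

theorem binomCoeff_nonneg {l : ℝ} (hl : 0 < l) (m : ℕ) : 0 ≤ binomCoeff l m :=
  Finset.prod_nonneg fun i _ => by positivity

theorem ring_choose_eq (l : ℝ) (m : ℕ) :
    Ring.choose ((l : ℂ) + m - 1) m = (binomCoeff l m : ℂ) := by
  have h := Ring.factorial_nsmul_multichoose_eq_ascPochhammer (l : ℂ) m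
  have h2 : (ascPochhammer ℕ m).smeval (l : ℂ) = (m.factorial : ℂ) * (binomCoeff l m : ℂ) := by
    induction m with
    | zero => simp [binomCoeff]
    | succ m ih =>
      rw [Polynomial.ascPochhammer_smeval_eq_eval, ascPochhammer_succ_eval, ← Polynomial.ascPochhammer_smeval_eq_eval,
        ih (Ring.factorial_nsmul_multichoose_eq_ascPochhammer (l : ℂ) m)]
      have : ((m : ℂ) + 1) ≠ 0 := by exact_mod_cast Nat.succ_ne_zero m
      have hb : binomCoeff l (m + 1) = binomCoeff l m * ((l + m) / (m + 1)) := by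
        rw [binomCoeff, Finset.prod_range_succ, ← binomCoeff]
      rw [hb, Nat.factorial_succ]
      push_cast
      field_simp
  rw [h2, nsmul_eq_mul] at h
  have h3 := mul_left_cancel₀ (by exact_mod_cast m.factorial_ne_zero) h
  rw [← h3, Ring.choose]
  congr 1
  ring

theorem hasSum_binom (l : ℝ) {t : ℂ} (ht : ‖t‖ < 1) :
    HasSum (fun m => (binomCoeff l m : ℂ) * t ^ m) ((1 - t) ^ (-(l : ℂ))) := by
  have h := (Complex.one_div_one_sub_cpow_hasFPowerSeriesOnBall_zero (l : ℂ)).hasSum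
    (y := t) (by simpa [enorm_eq_nnnorm, ← NNReal.coe_lt_coe] using ht)
  simp only [ring_choose_eq, FormalMultilinearSeries.ofScalars_apply_eq, zero_add, one_div,
    smul_eq_mul] at h
  rwa [Complex.cpow_neg]

theorem hasSum_binom_sub (l : ℝ) {t : ℂ} (ht : ‖t‖ < 1) (D : ℝ) :
    HasSum (fun m => ((D * binomCoeff l m - (if m = 0 then 0 else binomCoeff l (m - 1)) : ℝ) : ℂ)
      * t ^ m) ((D - t) * (1 - t) ^ (-(l : ℂ))) := by
  have h := hasSum_binom l ht
  have h1 := h.mul_left (D : ℂ)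
  have h2 : HasSum (fun m : ℕ => ((if m = 0 then 0 else binomCoeff l (m - 1) : ℝ) : ℂ) * t ^ m)
      (t * (1 - t) ^ (-(l : ℂ))) := by
    rw [← hasSum_nat_add_iff' 1]
    simp only [Finset.range_one, Finset.sum_singleton, if_true, Complex.ofReal_zero, zero_mul,
      sub_zero, Nat.add_sub_cancel, Nat.succ_ne_zero, if_false]
    refine (h.mul_left t).congr_fun ?_
    intro m
    ring
  have h3 := h1.sub h2
  rw [← sub_mul] at h3
  refine h3.congr_fun fun m => ?_
  push_cast
  ring

theorem binomCoeff_sub_nonneg {l : ℝ} (hl : 0 < l) (m : ℕ) :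
    0 ≤ (1 + l⁻¹) * binomCoeff l m - (if m = 0 then 0 else binomCoeff l (m - 1)) := by
  rcases m with _ | m
  · simp [binomCoeff]; positivity
  · simp only [Nat.add_sub_cancel, Nat.succ_ne_zero, if_false]
    have h0 := binomCoeff_nonneg hl m
    have : binomCoeff l (m + 1) = binomCoeff l m * ((l + m) / (m + 1)) := by
      rw [binomCoeff, Finset.prod_range_succ, ← binomCoeff]
    rw [this]
    have h1 : 1 ≤ (1 + l⁻¹) * ((l + m) / (m + 1)) := by
      have : (1 + l⁻¹) * ((l + m) / (m + 1)) = 1 + (l ^ 2 + m) / (l * (m + 1)) := by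
        field_simp; ring
      rw [this]
      have : 0 ≤ (l ^ 2 + m) / (l * (m + 1)) := by positivity
      linarith
    nlinarith

theorem norm_mul_conj_lt {z w : ℂ} (hz : ‖z‖ < 1) (hw : ‖w‖ < 1) : ‖z * conj w‖ < 1 := by
  rw [norm_mul, RCLike.norm_conj]
  exact mul_lt_one_of_nonneg_of_lt_one_left (norm_nonneg _) hz hw.le

theorem isPSD_prod {n : ℕ} {l : ℝ} (hl : 0 < l) (s : Finset (Fin n)) :
    IsPSD (fun z w : polydisc n => ∏ j ∈ s, (1 - z.1 j * conj (w.1 j)) ^ (-(l : ℂ))) := by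
  induction s using Finset.induction_on with
  | empty => simpa using isPSD_one
  | insert a s ha ih =>
    simp only [Finset.prod_insert ha]
    refine IsPSD.mul_of_hasSum (binomCoeff l) (fun m z => z.1 a ^ m) (binomCoeff_nonneg hl)
      (fun z w => ?_) ih
    simpa [mul_pow] using hasSum_binom l (norm_mul_conj_lt (z.2 a) (w.2 a))

theorem isPSD_scalarKernel {n : ℕ} {l : ℝ} (hl : 0 < l) :
    IsPSD (fun z w : polydisc n => scalarKernel n l z w) := isPSD_prod hl _

theorem isPSD_sub_mul {n : ℕ} {l : ℝ} (hl : 0 < l) (i : Fin n) :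
    IsPSD (fun z w : polydisc n =>
      ((1 + l⁻¹ : ℝ) - z.1 i * conj (w.1 i)) * scalarKernel n l z w) := by
  have := IsPSD.mul_of_hasSum (X := polydisc n) _ (fun m z => z.1 i ^ m) (binomCoeff_sub_nonneg hl)
    (fun z w => by
      simpa [mul_pow] using hasSum_binom_sub l (norm_mul_conj_lt (z.2 i) (w.2 i)) (1 + l⁻¹))
    (isPSD_prod hl (Finset.univ.erase i))
  convert this using 3 with z w
  rw [scalarKernel, ← Finset.mul_prod_erase _ _ (Finset.mem_univ i)]
  push_cast
  ring

theorem scalarKernel_conj {n : ℕ} (l : ℝ) (z w : polydisc n) :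
    conj (scalarKernel n l z w) = scalarKernel n l w z := by
  rw [scalarKernel, map_prod]
  refine Finset.prod_congr rfl fun j _ => ?_
  have h : (1 - z.1 j * conj (w.1 j)).arg ≠ Real.pi := by
    have := norm_mul_conj_lt (z.2 j) (w.2 j)
    have h2 := (abs_le.1 (Complex.abs_re_le_norm (z.1 j * conj (w.1 j)))).2
    refine (Complex.mem_slitPlane_iff_arg.1 (Or.inl ?_)).1
    simp only [Complex.sub_re, Complex.one_re]
    linarith
  have := Complex.conj_cpow _ (-(l : ℂ)) h
  simp only [map_neg, Complex.conj_ofReal] at this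
  rw [← this]
  simp [mul_comm]

/-- The kernel `K^(λ)` on the polydisc, written as in Mathlib with values in `ℂ →L[ℂ] ℂ`:
the entry at `(z, w)` is multiplication by the number `K^(λ)(z, w)`. -/
noncomputable def bergmanKernel (n : ℕ) (l : ℝ) : Matrix (polydisc n) (polydisc n) (ℂ →L[ℂ] ℂ) :=
  Matrix.of fun z w => scalarKernel n l z w • ContinuousLinearMap.id ℂ ℂ

open scoped ComplexOrder in
instance fact_posSemidef (n : ℕ) (l : ℝ) [hl : Fact (0 < l)] :
    Fact (bergmanKernel n l).PosSemidef := by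
  constructor
  have htfae := (RKHS.posSemidef_tfae (K := bergmanKernel n l)).out 0 2
  refine htfae.mpr ⟨?_, fun v => ?_⟩
  · ext z w
    simp only [Matrix.conjTranspose_apply, bergmanKernel, Matrix.of_apply]
    rw [star_smul, ContinuousLinearMap.star_eq_adjoint, ContinuousLinearMap.adjoint_id]
    simp [← scalarKernel_conj l w z]
  · have := isPSD_scalarKernel (n := n) hl.out v.support v
    simp only [Finsupp.sum]
    convert this using 1
    simp only [RCLike.re_eq_complex_re]
    congr 1
    refine Finset.sum_congr rfl fun x _ => Finset.sum_congr rfl fun y _ => ?_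
    simp [bergmanKernel, RCLike.inner_apply, ← scalarKernel_conj l y x]
    ring

/-- The weighted Bergman space `𝔸^(λ)(𝔻ⁿ)`, `λ > 0`: the Hilbert space of functions on the polydisc
whose reproducing kernel is `K^(λ)`. An element `f` is evaluated at `z : polydisc n` as `f z`. -/
abbrev WeightedBergman (n : ℕ) (l : ℝ) [Fact (0 < l)] : Type :=
  RKHS.OfKernel (bergmanKernel n l)


/-- The kernel function `K^(λ)(·, w)`, as an element of the Hilbert space. -/
noncomputable def kernelFun (n : ℕ) (l : ℝ) [Fact (0 < l)] (w : polydisc n) :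
    WeightedBergman n l := RKHS.kerFun (WeightedBergman n l) w 1

/-- `kernelFun n l w` is the function `z ↦ K^(λ)(z, w)`. -/
theorem kernelFun_apply (n : ℕ) (l : ℝ) [Fact (0 < l)] (w z : polydisc n) :
    kernelFun n l w z = scalarKernel n l z w := by
  rw [kernelFun, RKHS.kerFun_apply, RKHS.OfKernel.kernel_ofKernel]
  simp [bergmanKernel]

/-- The reproducing property (the inner product is conjugate linear in the first slot). -/
theorem inner_kernelFun (n : ℕ) (l : ℝ) [Fact (0 < l)] (w : polydisc n)
    (f : WeightedBergman n l) : ⟪kernelFun n l w, f⟫_ℂ = f w := by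
  simp [kernelFun]

/-- Multiplication by a coordinate function is a bounded operator. -/
theorem exists_mul_coord (n : ℕ) (l : ℝ) [hl : Fact (0 < l)] (i : Fin n) :
    ∃ T : WeightedBergman n l →L[ℂ] WeightedBergman n l, ∀ f z, T f z = z.1 i * f z := by
  let e : (polydisc n →₀ ℂ) →ₗ[ℂ] WeightedBergman n l :=
    Finsupp.linearCombination ℂ (kernelFun n l)
  let g : (polydisc n →₀ ℂ) →ₗ[ℂ] WeightedBergman n l :=
    Finsupp.linearCombination ℂ (fun w : polydisc n => conj (w.1 i) • kernelFun n l w)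
  have he : DenseRange e := by
    have h := RKHS.kerFun_dense (WeightedBergman n l)
    rw [← Submodule.dense_iff_topologicalClosure_eq_top] at h
    refine h.mono ?_
    rw [← LinearMap.coe_range]
    refine Submodule.span_le.2 ?_
    rintro _ ⟨x, v, rfl⟩
    refine ⟨Finsupp.single x v, ?_⟩
    simp only [e, Finsupp.linearCombination_single, kernelFun]
    rw [← map_smul]; simp
  have hinner : ∀ x y : polydisc n, ⟪kernelFun n l x, kernelFun n l y⟫_ℂ = scalarKernel n l x y :=
    fun x y => by rw [inner_kernelFun, kernelFun_apply]
  have hbound : ∀ v, ‖g v‖ ≤ √(1 + l⁻¹) * ‖e v‖ := by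
    intro v
    have h := isPSD_sub_mul (n := n) hl.out i v.support v
    have h1 : ⟪e v, e v⟫_ℂ = ∑ x ∈ v.support, ∑ y ∈ v.support,
        conj (v x) * v y * scalarKernel n l x y := by
      simp only [e, Finsupp.linearCombination_apply, Finsupp.sum, sum_inner, inner_sum,
        inner_smul_left, inner_smul_right, hinner, Finset.mul_sum]
      rw [Finset.sum_comm]
      refine Finset.sum_congr rfl fun x _ => Finset.sum_congr rfl fun y _ => ?_
      ring
    have h2 : ⟪g v, g v⟫_ℂ = ∑ x ∈ v.support, ∑ y ∈ v.support,
        conj (v x) * v y * (x.1 i * conj (y.1 i) * scalarKernel n l x y) := by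
      simp only [g, Finsupp.linearCombination_apply, Finsupp.sum, sum_inner, inner_sum,
        inner_smul_left, inner_smul_right, hinner, Complex.conj_conj, Finset.mul_sum]
      rw [Finset.sum_comm]
      refine Finset.sum_congr rfl fun x _ => Finset.sum_congr rfl fun y _ => ?_
      ring
    have h3 : ∑ x ∈ v.support, ∑ y ∈ v.support, conj (v x) * v y *
        (((1 + l⁻¹ : ℝ) - x.1 i * conj (y.1 i)) * scalarKernel n l x y)
        = ((1 + l⁻¹ : ℝ) : ℂ) * ⟪e v, e v⟫_ℂ - ⟪g v, g v⟫_ℂ := by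
      rw [h1, h2, Finset.mul_sum, ← Finset.sum_sub_distrib]
      refine Finset.sum_congr rfl fun x _ => ?_
      rw [Finset.mul_sum, ← Finset.sum_sub_distrib]
      refine Finset.sum_congr rfl fun y _ => ?_
      ring
    have hre : ∀ x : WeightedBergman n l, (⟪x, x⟫_ℂ).re = ‖x‖ ^ 2 := fun x =>
      inner_self_eq_norm_sq (𝕜 := ℂ) x
    rw [h3, Complex.sub_re, Complex.re_ofReal_mul, hre, hre] at h
    have hpos : (0 : ℝ) ≤ 1 + l⁻¹ := by have := hl.out; positivity
    refine (sq_le_sq₀ (norm_nonneg _) (by positivity)).1 ?_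
    rw [mul_pow, Real.sq_sqrt hpos]
    linarith
  let S := g.extendOfNorm e
  have hS : ∀ w, S (kernelFun n l w) = conj (w.1 i) • kernelFun n l w := by
    intro w
    have := LinearMap.extendOfNorm_eq he ⟨_, hbound⟩ (Finsupp.single w 1)
    simpa [e, g] using this
  refine ⟨S.adjoint, fun f z => ?_⟩
  rw [← inner_kernelFun, ContinuousLinearMap.adjoint_inner_right, hS, inner_smul_left,
    inner_kernelFun, Complex.conj_conj]

/-- Multiplication by a polynomial is a bounded operator. -/
theorem exists_mul_poly (n : ℕ) (l : ℝ) [Fact (0 < l)] (p : MvPolynomial (Fin n) ℂ) :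
    ∃ T : WeightedBergman n l →L[ℂ] WeightedBergman n l,
      ∀ f z, T f z = MvPolynomial.eval z.1 p * f z := by
  induction p using MvPolynomial.induction_on with
  | C a => exact ⟨a • ContinuousLinearMap.id ℂ _, fun f z => by simp⟩
  | add p q hp hq =>
    obtain ⟨S, hS⟩ := hp
    obtain ⟨T, hT⟩ := hq
    exact ⟨S + T, fun f z => by simp [hS, hT, add_mul]⟩
  | mul_X p i hp =>
    obtain ⟨S, hS⟩ := hp
    obtain ⟨T, hT⟩ := exists_mul_coord n l i
    exact ⟨S * T, fun f z => by simp [hS, hT, mul_assoc]⟩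

/-- The bounded operator of pointwise multiplication by the polynomial `p`; see `mulOp_apply`. -/
noncomputable def mulOp (n : ℕ) (l : ℝ) [Fact (0 < l)] (p : MvPolynomial (Fin n) ℂ) :
    WeightedBergman n l →L[ℂ] WeightedBergman n l := (exists_mul_poly n l p).choose

theorem mulOp_apply (n : ℕ) (l : ℝ) [Fact (0 < l)] (p : MvPolynomial (Fin n) ℂ)
    (f : WeightedBergman n l) (z : polydisc n) :
    mulOp n l p f z = MvPolynomial.eval z.1 p * f z := (exists_mul_poly n l p).choose_spec f z

/-- The Hilbert module structure of `𝔸^(λ)(𝔻ⁿ)` over `ℂ[z₁, …, zₙ]`, by pointwise multiplication. -/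
noncomputable def polyAction (n : ℕ) (l : ℝ) [Fact (0 < l)] :
    MvPolynomial (Fin n) ℂ →ₐ[ℂ] (WeightedBergman n l →L[ℂ] WeightedBergman n l) where
  toFun := mulOp n l
  map_one' := by ext f z; simp [mulOp_apply]
  map_mul' p q := by ext f z; simp [mulOp_apply, mul_assoc]
  map_zero' := by ext f z; simp [mulOp_apply]
  map_add' p q := by ext f z; simp [mulOp_apply, add_mul]
  commutes' a := by ext f z; simp [mulOp_apply, Algebra.algebraMap_eq_smul_one]

/-- The Hilbert module structure of `𝔸^(λ)(𝔻ⁿ)` over the symmetric polynomials. -/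
noncomputable def symAction (n : ℕ) (l : ℝ) [Fact (0 < l)] :
    MvPolynomial.symmetricSubalgebra (Fin n) ℂ →ₐ[ℂ]
      (WeightedBergman n l →L[ℂ] WeightedBergman n l) :=
  (polyAction n l).comp (MvPolynomial.symmetricSubalgebra (Fin n) ℂ).val

theorem symAction_apply (n : ℕ) (l : ℝ) [Fact (0 < l)]
    (p : MvPolynomial.symmetricSubalgebra (Fin n) ℂ) (f : WeightedBergman n l) (z : polydisc n) :
    symAction n l p f z = MvPolynomial.eval z.1 p.1 * f z := mulOp_apply n l p.1 f z

/-- The symmetrization map `s = (s₁, …, sₙ) : ℂⁿ → ℂⁿ`, whose entry with index `k : Fin n` is the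
elementary symmetric function of degree `k + 1`. -/
noncomputable def symmetrization (n : ℕ) (z : Fin n → ℂ) : Fin n → ℂ :=
  fun k => MvPolynomial.eval z (MvPolynomial.esymm (Fin n) ℂ (k + 1))

/-- The symmetrized polydisc `𝔾ₙ = s(𝔻ⁿ)`. -/
def symmetrizedPolydisc (n : ℕ) : Set (Fin n → ℂ) := symmetrization n '' polydisc n

/-- The set `𝒵` of points of the polydisc with two equal coordinates. -/
def diagonalSet (n : ℕ) : Set (Fin n → ℂ) :=
  {z | z ∈ polydisc n ∧ ∃ i j, i ≠ j ∧ z i = z j}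

/-- The set `𝔾ₙ \ s(𝒵)`. -/
def regularSet (n : ℕ) : Set (Fin n → ℂ) :=
  symmetrizedPolydisc n \ (symmetrization n '' diagonalSet n)

/-- The character of `ℂ[z]^𝔖ₙ = ℂ[s₁, …, sₙ]` given by a point `u ∈ ℂⁿ`: it sends
`q(s₁, …, sₙ)` to `q(u)`. For `u = s(w)` it is evaluation at `w`; see `symEval_symmetrization`. -/
noncomputable def symEval (n : ℕ) (u : Fin n → ℂ) :
    MvPolynomial.symmetricSubalgebra (Fin n) ℂ →ₐ[ℂ] ℂ :=
  (MvPolynomial.aeval u).comp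
    (MvPolynomial.esymmAlgEquiv (Fin n) ℂ (Fintype.card_fin n)).symm.toAlgHom

theorem symEval_symmetrization (n : ℕ) (w : Fin n → ℂ)
    (p : MvPolynomial.symmetricSubalgebra (Fin n) ℂ) :
    symEval n (symmetrization n w) p = MvPolynomial.eval w p.1 := by
  obtain ⟨q, rfl⟩ := (MvPolynomial.esymmAlgEquiv (Fin n) ℂ (Fintype.card_fin n)).surjective p
  have h : (MvPolynomial.aeval (symmetrization n w) : MvPolynomial (Fin n) ℂ →ₐ[ℂ] ℂ) =
      ((MvPolynomial.aeval w).comp (MvPolynomial.symmetricSubalgebra (Fin n) ℂ).val).comp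
        (MvPolynomial.esymmAlgEquiv (Fin n) ℂ (Fintype.card_fin n)).toAlgHom := by
    ext i
    simp [symmetrization, MvPolynomial.esymmAlgEquiv, MvPolynomial.esymmAlgHom,
      MvPolynomial.aeval_eq_eval]
  have h2 := DFunLike.congr_fun h q
  change MvPolynomial.aeval (symmetrization n w)
    ((MvPolynomial.esymmAlgEquiv (Fin n) ℂ (Fintype.card_fin n)).symm
      (MvPolynomial.esymmAlgEquiv (Fin n) ℂ (Fintype.card_fin n) q)) = _
  rw [AlgEquiv.symm_apply_apply]
  simpa [MvPolynomial.aeval_eq_eval] using h2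

section LocallyFree

variable {n : ℕ} {R : Type*} [CommRing R] [Algebra ℂ R]
  {H : Type*} [NormedAddCommGroup H] [InnerProductSpace ℂ H]

/-- For a Hilbert module `ρ` over `R` and the one-dimensional module `ℂ_χ` given by a character
`χ` of `R`: the closed subspace `𝒩` of `H ⊗ ℂ_χ = H` spanned by the vectors
`p · f ⊗ 1 - f ⊗ χ(p)`. -/
noncomputable def tensorRelations (ρ : R →ₐ[ℂ] (H →L[ℂ] H)) (χ : R →ₐ[ℂ] ℂ) : Submodule ℂ H :=
  (Submodule.span ℂ {g | ∃ (p : R) (f : H), g = ρ p f - χ p • f}).topologicalClosure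

/-- The module tensor product `H ⊗_R ℂ_χ`: the Hilbert space quotient `(H ⊗ ℂ_χ) / 𝒩`, realized
as the orthogonal complement of `𝒩` in `H ⊗ ℂ_χ = H`. -/
noncomputable def moduleTensor (ρ : R →ₐ[ℂ] (H →L[ℂ] H)) (χ : R →ₐ[ℂ] ℂ) : Submodule ℂ H :=
  (tensorRelations ρ χ)ᗮ

/-- `Ω* = {z : conj z ∈ Ω}`. -/
def conjSet (Ω : Set (Fin n → ℂ)) : Set (Fin n → ℂ) := {z | star z ∈ Ω}

/-- The functions `γ₁, …, γ_k` are holomorphic on `V ⊆ Ω*`, and for every `v ∈ V` the vectors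
`γ₁(v), …, γ_k(v)` are linearly independent and span the module tensor product of `H` with the
one-dimensional module at the point `conj v` of `Ω`. Here `ev u` is the character of `R` given by
the point `u`. -/
structure IsHolomorphicFrame (ρ : R →ₐ[ℂ] (H →L[ℂ] H)) (ev : (Fin n → ℂ) → (R →ₐ[ℂ] ℂ))
    (V : Set (Fin n → ℂ)) {k : ℕ} (γ : Fin k → (Fin n → ℂ) → H) : Prop where
  holomorphic : ∀ i, DifferentiableOn ℂ (γ i) V
  linearIndependent : ∀ v ∈ V, LinearIndependent ℂ fun i => γ i v
  span_eq : ∀ v ∈ V, Submodule.span ℂ (Set.range fun i => γ i v) = moduleTensor ρ (ev (star v))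

/-- The Hilbert module `ρ` is locally free of rank `k` on the bounded domain `Ω ⊆ ℂⁿ`. -/
structure IsLocallyFreeOn (ρ : R →ₐ[ℂ] (H →L[ℂ] H)) (ev : (Fin n → ℂ) → (R →ₐ[ℂ] ℂ))
    (Ω : Set (Fin n → ℂ)) (k : ℕ) : Prop where
  isBounded : Bornology.IsBounded Ω
  isOpen : IsOpen Ω
  isConnected : IsConnected Ω
  locallyFree : ∀ w ∈ conjSet Ω, ∃ V : Set (Fin n → ℂ), IsOpen V ∧ w ∈ V ∧ V ⊆ conjSet Ω ∧
    ∃ γ : Fin k → (Fin n → ℂ) → H, IsHolomorphicFrame ρ ev V γ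

end LocallyFree

/-- `φ₁, …, φ_{n!}` is an enumeration of the `n!` local inverses on `U` of the symmetrization map
`s : 𝔻ⁿ → 𝔾ₙ`: they are holomorphic on `U`, satisfy `s ∘ φᵢ = id` there, and at each point of `U`
their values are pairwise distinct and exhaust the fibre of `s`. -/
structure IsLocalInverses (n : ℕ) (U : Set (Fin n → ℂ))
    (φ : Fin n.factorial → (Fin n → ℂ) → polydisc n) : Prop where
  holomorphic : ∀ i, DifferentiableOn ℂ (fun u => (φ i u).1) U
  symmetrization_eq : ∀ i, ∀ u ∈ U, symmetrization n (φ i u).1 = u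
  injective : ∀ u ∈ U, Function.Injective fun i => φ i u
  exhaust : ∀ u ∈ U, ∀ z : polydisc n, symmetrization n z.1 = u → ∃ i, φ i u = z

end BergmanModule

/-!
For `u = s(w)` in `Ω` the coordinates of `w` are distinct, and the fibre of `s` over `u` consists of
the `n!` points `w ∘ σ`. The module tensor product at `u` consists of the `g` with
`⟪p f, g⟫ = conj (p(w)) ⟪f, g⟫` for all symmetric `p`, so it contains the kernel functions of the
points of the fibre, which are independent because polynomials separate points.

They span it for an algebraic reason. Given such a `g`, the functional `ℓ(p) = ⟪g, p⟫` on
`ℂ[z₁, …, zₙ]` satisfies `ℓ(q p) = q(w) ℓ(p)` for symmetric `q`. Modulo the ideal of the `q - q(w)`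
every coordinate `zⱼ` satisfies `∏ᵢ (zⱼ - wᵢ) = 0`, so the Lagrange basis polynomials for the nodes
`wᵢ`, evaluated at `zⱼ`, give a decomposition of `1` into joint eigenvectors indexed by the maps
`τ : Fin n → Fin n`; those with `w ∘ τ` outside the fibre vanish. Hence `ℓ(p)` depends only on the
values of `p` on the fibre (`apply_eq_zero_of_eval_fibre_eq_zero`), and as the polynomials are dense
`g` is a combination of kernel functions (`moduleTensor_le_span_kernelFun`).

Holomorphy of `w ↦ K(·, conj w)` and density of the polynomials both come from the formula
`K(·, conj v) = ∏ⱼ (1 - vⱼ Mⱼ)^(-λ) 1`, where `Mⱼ` is multiplication by `zⱼ`. The binomial series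
converges in operator norm on the unit disc because `‖Mⱼ^m‖ ≤ 1 + m / λ` (`norm_mulOp_X_pow_le`),
which in turn is a positivity statement about the kernel.

Local inverses of `s` come from the inverse function theorem: differentiating
`∏ⱼ (wᵢ - zⱼ) = wᵢⁿ + ∑ₖ ± sₖ(z) wᵢ^(n-k)` at `z = w` shows that the derivative of `s` is injective,
and one local inverse yields all others by permuting coordinates. Finally `Ω` is the image under `s`
of the points of the polydisc with distinct coordinates, and these form a connected set since a
complex line through two such points leaves it in countably many parameters only.
-/

namespace BergmanModule

open scoped ComplexConjugate InnerProductSpace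

/-! ### Fibres of the symmetrization map -/

/-- Vieta's formula, with the `xᵢ` in an arbitrary commutative `ℂ`-algebra; the term `tⁿ` is split
off so that the sum runs over the same indices as the entries of `symmetrization`. -/
theorem prod_sub_eq_sum_esymm {n : ℕ} {A : Type*} [CommRing A] [Algebra ℂ A]
    (x : Fin n → A) (t : A) :
    ∏ i, (t - x i) = t ^ n + ∑ k : Fin n, (-1) ^ ((k : ℕ) + 1) *
      MvPolynomial.aeval x (MvPolynomial.esymm (Fin n) ℂ (k + 1)) * t ^ (n - 1 - k) := by
  have h := congrArg (Polynomial.eval t)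
    (Multiset.prod_X_sub_X_eq_sum_esymm (Finset.univ.val.map x))
  rw [Polynomial.eval_multiset_prod, Polynomial.eval_finsetSum] at h
  simp only [Multiset.map_map, Function.comp_def, Polynomial.eval_sub, Polynomial.eval_X,
    Polynomial.eval_C, Multiset.card_map, Finset.card_val, Finset.card_univ, Fintype.card_fin,
    Polynomial.eval_mul, Polynomial.eval_pow, Polynomial.eval_neg, Polynomial.eval_one] at h
  rw [Finset.prod_eq_multiset_prod, h, Finset.sum_range_succ', Finset.sum_range, add_comm]
  congr 1
  · simp [Multiset.esymm, Multiset.powersetCard_zero_left]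
  · refine Finset.sum_congr rfl fun k _ => ?_
    rw [MvPolynomial.aeval_esymm_eq_multiset_esymm, mul_assoc, add_comm (k : ℕ) 1, Nat.sub_add_eq]

theorem prod_sub_eq_sum_symmetrization {n : ℕ} (z : Fin n → ℂ) (t : ℂ) :
    ∏ i, (t - z i) = t ^ n + ∑ k : Fin n, (-1) ^ ((k : ℕ) + 1) *
      symmetrization n z k * t ^ (n - 1 - k) := by
  simpa [MvPolynomial.aeval_eq_eval, symmetrization] using prod_sub_eq_sum_esymm z t

/-- Only one of the two points is assumed to have distinct coordinates. -/
theorem exists_perm_of_symmetrization_eq {n : ℕ} {z w : Fin n → ℂ} (hw : Function.Injective w)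
    (h : symmetrization n z = symmetrization n w) : ∃ σ : Equiv.Perm (Fin n), z = w ∘ σ := by
  -- Each `wᵢ` is a root of `∏ⱼ (t - wⱼ) = ∏ⱼ (t - zⱼ)`.
  have h1 : ∀ i, ∃ j, w i = z j := fun i => by
    have h2 : ∏ j, (w i - z j) = 0 := by
      rw [prod_sub_eq_sum_symmetrization, h, ← prod_sub_eq_sum_symmetrization]
      exact Finset.prod_eq_zero (Finset.mem_univ i) (sub_self _)
    obtain ⟨j, -, hj⟩ := Finset.prod_eq_zero_iff.1 h2
    exact ⟨j, sub_eq_zero.1 hj⟩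
  choose ρ hρ using h1
  have hinj : Function.Injective ρ := fun i j hij => hw (by rw [hρ, hρ, hij])
  refine ⟨(Equiv.ofBijective ρ (Finite.injective_iff_bijective.1 hinj)).symm, funext fun j => ?_⟩
  rw [Function.comp_apply, hρ]
  exact congrArg z (Equiv.ofBijective_apply_symm_apply ρ _ j).symm

theorem symmetrization_comp_perm {n : ℕ} (z : Fin n → ℂ) (σ : Equiv.Perm (Fin n)) :
    symmetrization n (z ∘ σ) = symmetrization n z := by
  funext k
  have := MvPolynomial.esymm_isSymmetric (Fin n) ℂ (k + 1) σ
  simp only [symmetrization]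
  conv_rhs => rw [← this, MvPolynomial.eval_rename]

/-- A functional on `ℂ[z₁, …, zₙ]` on which the symmetric polynomials act through their values at a
point `w` with distinct coordinates depends only on values on the fibre of `s` through `w`. In other
words, the ideal generated by the `q - q(w)` is radical. -/
theorem apply_eq_zero_of_eval_fibre_eq_zero {n : ℕ} {w : Fin n → ℂ} (hw : Function.Injective w)
    (ℓ : MvPolynomial (Fin n) ℂ →ₗ[ℂ] ℂ)
    (hℓ : ∀ q : MvPolynomial (Fin n) ℂ, q.IsSymmetric → ∀ p,
      ℓ (q * p) = MvPolynomial.eval w q * ℓ p)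
    (p : MvPolynomial (Fin n) ℂ)
    (hp : ∀ z, symmetrization n z = symmetrization n w → MvPolynomial.eval z p = 0) :
    ℓ p = 0 := by
  -- The largest ideal on which `ℓ` vanishes; it contains all `q - q(w)` with `q` symmetric.
  let J : Ideal (MvPolynomial (Fin n) ℂ) :=
    { carrier := {p | ∀ r, ℓ (r * p) = 0}
      add_mem' := fun {a b} ha hb r => by rw [mul_add, map_add, ha r, hb r, add_zero]
      zero_mem' := fun r => by simp
      smul_mem' := fun c a ha r => by rw [smul_eq_mul, ← mul_assoc]; exact ha _ }
  suffices h : p ∈ J by simpa using h 1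
  let π := Ideal.Quotient.mkₐ ℂ J
  let a := algebraMap ℂ (MvPolynomial (Fin n) ℂ ⧸ J)
  let x : Fin n → MvPolynomial (Fin n) ℂ ⧸ J := fun j => π (MvPolynomial.X j)
  have hx : ∀ q, MvPolynomial.aeval x q = π q := fun q => by
    rw [MvPolynomial.aeval_unique π]
    rfl
  have hsym : ∀ q : MvPolynomial (Fin n) ℂ, q.IsSymmetric → π q = a (MvPolynomial.eval w q) := by
    intro q hq
    have : π q = π (MvPolynomial.C (MvPolynomial.eval w q)) := by
      refine Ideal.Quotient.eq.2 fun r => ?_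
      rw [mul_comm, sub_mul, map_sub, hℓ q hq, ← MvPolynomial.smul_eq_C_mul, map_smul, smul_eq_mul,
        sub_self]
    rw [this, ← MvPolynomial.algebraMap_eq, AlgHom.commutes]
  have hroot : ∀ j, ∏ i, (x j - a (w i)) = 0 := by
    intro j
    have h1 := prod_sub_eq_sum_esymm x (x j)
    have h2 := prod_sub_eq_sum_esymm (fun i => a (w i)) (x j)
    rw [h2, ← Finset.prod_eq_zero (f := fun i => x j - x i) (Finset.mem_univ j) (sub_self _), h1]
    refine congrArg _ (Finset.sum_congr rfl fun k _ => ?_)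
    rw [hx, hsym _ (MvPolynomial.esymm_isSymmetric _ _ _)]
    congr 2
    exact MvPolynomial.aeval_algebraMap_apply _ _ _
  -- `e j i` is the spectral projection of the `j`-th coordinate for the eigenvalue `wᵢ`.
  let e : Fin n → Fin n → MvPolynomial (Fin n) ℂ ⧸ J := fun j i =>
    Polynomial.aeval (x j) (Lagrange.basis Finset.univ w i)
  have he_sum : ∀ j, ∑ i, e j i = 1 := fun j => by
    have := Lagrange.sum_basis (s := Finset.univ) (v := w) hw.injOn ⟨j, Finset.mem_univ j⟩
    simp only [e]
    rw [← map_sum, this, map_one]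
  have he_mul : ∀ j i, x j * e j i = a (w i) * e j i := fun j i => by
    have h1 : (Polynomial.X - Polynomial.C (w i)) * Lagrange.basis Finset.univ w i =
        Polynomial.C (Lagrange.nodalWeight Finset.univ w i) *
          ∏ k, (Polynomial.X - Polynomial.C (w k)) := by
      rw [Lagrange.basis_eq_prod_sub_inv_mul_nodal_div (Finset.mem_univ i), mul_left_comm,
        ← Lagrange.nodal_erase_eq_nodal_div (Finset.mem_univ i),
        ← Lagrange.nodal_eq_mul_nodal_erase (Finset.mem_univ i), Lagrange.nodal_eq]
    have h2 := congrArg (Polynomial.aeval (x j)) h1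
    simp only [map_mul, map_sub, Polynomial.aeval_X, Polynomial.aeval_C, map_prod] at h2
    rw [hroot, mul_zero, sub_mul, sub_eq_zero] at h2
    exact h2
  let E : (Fin n → Fin n) → MvPolynomial (Fin n) ℂ ⧸ J := fun τ => ∏ j, e j (τ j)
  have hE_sum : ∑ τ, E τ = 1 := by
    have := Finset.prod_univ_sum (fun _ : Fin n => (Finset.univ : Finset (Fin n))) e
    rw [Fintype.piFinset_univ] at this
    rw [← this]
    simp [he_sum]
  have hE_mul : ∀ τ q, π q * E τ = a (MvPolynomial.eval (w ∘ τ) q) * E τ := by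
    intro τ q
    induction q using MvPolynomial.induction_on with
    | C c => rw [← MvPolynomial.algebraMap_eq, AlgHom.commutes]; simp [a]
    | add q r hq hr => simp only [map_add, add_mul, hq, hr]
    | mul_X q j hq =>
      have : x j * E τ = a (w (τ j)) * E τ := by
        simp only [E]
        rw [← Finset.mul_prod_erase _ _ (Finset.mem_univ j), ← mul_assoc, he_mul, mul_assoc]
      rw [map_mul, mul_assoc, this, mul_left_comm, hq, map_mul, MvPolynomial.eval_X, map_mul]
      simp only [Function.comp_apply]
      ring
  refine Ideal.Quotient.eq_zero_iff_mem.1 (show π p = 0 from ?_)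
  rw [← mul_one (π p), ← hE_sum, Finset.mul_sum]
  refine Finset.sum_eq_zero fun τ _ => ?_
  by_cases hτ : symmetrization n (w ∘ τ) = symmetrization n w
  · rw [hE_mul, hp _ hτ, map_zero, zero_mul]
  · -- Some `sₖ` acts on `E τ` by two different scalars, so `E τ = 0`.
    obtain ⟨k, hk⟩ := Function.ne_iff.1 hτ
    have h1 := hE_mul τ (MvPolynomial.esymm (Fin n) ℂ (k + 1))
    rw [hsym _ (MvPolynomial.esymm_isSymmetric _ _ _), ← sub_eq_zero, ← sub_mul, ← map_sub] at h1
    have h2 : IsUnit (a (MvPolynomial.eval w (MvPolynomial.esymm (Fin n) ℂ (k + 1)) -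
        MvPolynomial.eval (w ∘ τ) (MvPolynomial.esymm (Fin n) ℂ (k + 1)))) :=
      (sub_ne_zero.2 (Ne.symm hk)).isUnit.map a
    rw [h2.mul_right_eq_zero.1 h1, mul_zero]

theorem exists_eval_eq_ite {σ : Type*} {ι : Type*} [Fintype ι] [DecidableEq ι] {z : ι → σ → ℂ}
    (hz : Function.Injective z) (i : ι) :
    ∃ p : MvPolynomial σ ℂ, ∀ j, MvPolynomial.eval (z j) p = if j = i then 1 else 0 := by
  have h1 : ∀ j, ∃ p : MvPolynomial σ ℂ, j ≠ i →
      MvPolynomial.eval (z i) p = 1 ∧ MvPolynomial.eval (z j) p = 0 := by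
    intro j
    by_cases hj : j = i
    · exact ⟨0, fun h => (h hj).elim⟩
    obtain ⟨k, hk⟩ := Function.ne_iff.1 (hz.ne hj)
    refine ⟨MvPolynomial.C (z i k - z j k)⁻¹ * (MvPolynomial.X k - MvPolynomial.C (z j k)),
      fun _ => ⟨?_, ?_⟩⟩
    · simp [inv_mul_cancel₀ (sub_ne_zero.2 (Ne.symm hk))]
    · simp
  choose p hp using h1
  refine ⟨∏ j ∈ Finset.univ.erase i, p j, fun j => ?_⟩
  rw [map_prod]
  split_ifs with hj
  · subst hj
    exact Finset.prod_eq_one fun k hk => (hp k (Finset.ne_of_mem_erase hk)).1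
  · exact Finset.prod_eq_zero (Finset.mem_erase.2 ⟨hj, Finset.mem_univ j⟩) (hp j hj).2

/-! ### Powers of the coordinate multiplications -/

theorem binomCoeff_succ_param {l : ℝ} (hl : 0 < l) (m : ℕ) :
    binomCoeff (l + 1) m = binomCoeff l m * (1 + m / l) := by
  induction m with
  | zero => simp [binomCoeff]
  | succ m ih =>
    have h : ∀ a : ℝ, binomCoeff a (m + 1) = binomCoeff a m * ((a + m) / (m + 1)) := fun a => by
      rw [binomCoeff, Finset.prod_range_succ, ← binomCoeff]
    rw [h, h, ih]
    push_cast
    field_simp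
    ring

/-- This holds because `(1 + k / l) * binomCoeff l k = binomCoeff (l + 1) k` is increasing in `k`. -/
theorem binomCoeff_le_add {l : ℝ} (hl : 0 < l) (m k : ℕ) :
    binomCoeff l k ≤ (1 + m / l) * binomCoeff l (k + m) := by
  have hmono : binomCoeff (l + 1) k ≤ binomCoeff (l + 1) (k + m) := by
    refine monotone_nat_of_le_succ (f := binomCoeff (l + 1)) (fun i => ?_) (Nat.le_add_right k m)
    have : binomCoeff (l + 1) (i + 1) = binomCoeff (l + 1) i * ((l + 1 + i) / (i + 1)) := by
      rw [binomCoeff, Finset.prod_range_succ, ← binomCoeff]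
    rw [this]
    refine le_mul_of_one_le_right (binomCoeff_nonneg (by positivity) i) ?_
    rw [one_le_div (by positivity)]
    linarith
  rw [binomCoeff_succ_param hl, binomCoeff_succ_param hl] at hmono
  have hb := binomCoeff_nonneg hl (k + m)
  have hk : (0 : ℝ) < 1 + k / l := by positivity
  refine le_of_mul_le_mul_right (hmono.trans ?_) hk
  rw [mul_comm (1 + (m : ℝ) / l), mul_assoc]
  refine mul_le_mul_of_nonneg_left ?_ hb
  push_cast
  have : 0 ≤ (m : ℝ) / l * (k / l) := by positivity
  calc (1 : ℝ) + (k + m) / l = 1 + k / l + m / l := by ring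
    _ ≤ _ := by nlinarith

/-- Taylor expansion of `(D - t ^ m) (1 - t) ^ (-l)`. -/
theorem hasSum_binom_sub_pow (l : ℝ) {t : ℂ} (ht : ‖t‖ < 1) (D : ℝ) (m : ℕ) :
    HasSum (fun k => ((D * binomCoeff l k - (if k < m then 0 else binomCoeff l (k - m)) : ℝ) : ℂ)
      * t ^ k) ((D - t ^ m) * (1 - t) ^ (-(l : ℂ))) := by
  have h := hasSum_binom l ht
  have h2 : HasSum (fun k : ℕ => ((if k < m then 0 else binomCoeff l (k - m) : ℝ) : ℂ) * t ^ k)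
      (t ^ m * (1 - t) ^ (-(l : ℂ))) := by
    rw [← hasSum_nat_add_iff' m, Finset.sum_eq_zero fun i hi => by
      rw [if_pos (Finset.mem_range.1 hi), Complex.ofReal_zero, zero_mul], sub_zero]
    refine (h.mul_left (t ^ m)).congr_fun fun k => ?_
    rw [if_neg (by omega), Nat.add_sub_cancel]
    ring
  have h3 := (h.mul_left (D : ℂ)).sub h2
  rw [← sub_mul] at h3
  refine h3.congr_fun fun k => ?_
  push_cast
  ring

/-- The positivity that is equivalent to `‖Mᵢ ^ m‖ ^ 2 ≤ 1 + m / l`, where `Mᵢ` is multiplication by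
the `i`-th coordinate. -/
theorem isPSD_sub_pow_mul {n : ℕ} {l : ℝ} (hl : 0 < l) (i : Fin n) (m : ℕ) :
    IsPSD (fun z w : polydisc n =>
      ((1 + m / l : ℝ) - (z.1 i * conj (w.1 i)) ^ m) * scalarKernel n l z w) := by
  have := IsPSD.mul_of_hasSum (X := polydisc n)
    (g := fun m z => z.1 i ^ m)
    (b := fun k => (1 + m / l) * binomCoeff l k -
      (if k < m then 0 else binomCoeff l (k - m)))
    (fun k => by
      split_ifs with hk
      · have := binomCoeff_nonneg hl k
        rw [sub_zero]; positivity
      · have := binomCoeff_le_add hl m (k - m)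
        rw [Nat.sub_add_cancel (not_lt.1 hk)] at this
        linarith)
    (fun z w => by
      simpa [mul_pow] using
        hasSum_binom_sub_pow l (norm_mul_conj_lt (z.2 i) (w.2 i)) (1 + m / l) m)
    (isPSD_prod hl (Finset.univ.erase i))
  convert this using 3 with z w
  rw [scalarKernel, ← Finset.mul_prod_erase _ _ (Finset.mem_univ i)]
  push_cast
  ring

variable {n : ℕ} {l : ℝ} [hl : Fact (0 < l)]

theorem adjoint_mulOp_kernelFun (p : MvPolynomial (Fin n) ℂ) (w : polydisc n) :
    (mulOp n l p).adjoint (kernelFun n l w) = conj (MvPolynomial.eval w.1 p) • kernelFun n l w := by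
  refine ext_inner_right ℂ fun f => ?_
  rw [ContinuousLinearMap.adjoint_inner_left, inner_kernelFun, mulOp_apply, inner_smul_left,
    inner_kernelFun, Complex.conj_conj]

theorem closure_span_kernelFun :
    (Submodule.span ℂ (Set.range (kernelFun n l))).topologicalClosure = ⊤ := by
  rw [← RKHS.kerFun_dense (𝕜 := ℂ) (WeightedBergman n l)]
  congr 1
  refine le_antisymm (Submodule.span_mono ?_) (Submodule.span_le.2 ?_)
  · rintro _ ⟨w, rfl⟩
    exact ⟨w, 1, rfl⟩
  · rintro _ ⟨w, v, rfl⟩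
    have : RKHS.kerFun (WeightedBergman n l) w v = v • kernelFun n l w := by
      rw [kernelFun, ← map_smul, smul_eq_mul, mul_one]
    rw [this]
    exact Submodule.smul_mem _ _ (Submodule.subset_span ⟨w, rfl⟩)

/-- The powers of multiplication by a coordinate grow at most polynomially. The square root of the
bound also holds, but is not needed. -/
theorem norm_mulOp_X_pow_le (i : Fin n) (m : ℕ) :
    ‖mulOp n l (MvPolynomial.X i ^ m)‖ ≤ 1 + m / l := by
  have hpos : (1 : ℝ) ≤ 1 + m / l := by
    have := hl.out
    have : (0 : ℝ) ≤ m / l := by positivity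
    linarith
  set T := mulOp n l (MvPolynomial.X i ^ m)
  rw [← (ContinuousLinearMap.adjoint (𝕜 := ℂ)).norm_map T]
  refine ContinuousLinearMap.opNorm_le_bound _ (by linarith) fun f => ?_
  have hf : f ∈ (Submodule.span ℂ (Set.range (kernelFun n l))).topologicalClosure := by
    rw [closure_span_kernelFun]; trivial
  have hclosed : IsClosed {f : WeightedBergman n l | ‖T.adjoint f‖ ≤ (1 + m / l) * ‖f‖} :=
    isClosed_le (by fun_prop) (by fun_prop)
  refine closure_minimal (fun g hg => ?_) hclosed hf
  obtain ⟨v, rfl⟩ := (Finsupp.mem_span_range_iff_exists_finsupp).1 hg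
  have h := isPSD_sub_pow_mul (n := n) hl.out i m v.support v
  have hinner : ∀ x y : polydisc n, ⟪kernelFun n l x, kernelFun n l y⟫_ℂ = scalarKernel n l x y :=
    fun x y => by rw [inner_kernelFun, kernelFun_apply]
  set e := v.sum fun w a => a • kernelFun n l w with he
  have hTe : T.adjoint e = v.sum fun w a => a • conj (w.1 i ^ m) • kernelFun n l w := by
    simp only [he, Finsupp.sum, map_sum, map_smul, T, adjoint_mulOp_kernelFun, map_pow,
      MvPolynomial.eval_X]
  have h1 : ⟪e, e⟫_ℂ = ∑ x ∈ v.support, ∑ y ∈ v.support,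
      conj (v x) * v y * scalarKernel n l x y := by
    simp only [he, Finsupp.sum, sum_inner, inner_sum,
      inner_smul_left, inner_smul_right, hinner, Finset.mul_sum]
    rw [Finset.sum_comm]
    refine Finset.sum_congr rfl fun x _ => Finset.sum_congr rfl fun y _ => ?_
    ring
  have h2 : ⟪T.adjoint e, T.adjoint e⟫_ℂ = ∑ x ∈ v.support, ∑ y ∈ v.support,
      conj (v x) * v y * ((x.1 i * conj (y.1 i)) ^ m * scalarKernel n l x y) := by
    simp only [hTe, Finsupp.sum, sum_inner, inner_sum,
      inner_smul_left, inner_smul_right, hinner, Complex.conj_conj, Finset.mul_sum, map_pow, mul_pow]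
    rw [Finset.sum_comm]
    refine Finset.sum_congr rfl fun x _ => Finset.sum_congr rfl fun y _ => ?_
    ring
  have h3 : ∑ x ∈ v.support, ∑ y ∈ v.support, conj (v x) * v y *
      (((1 + m / l : ℝ) - (x.1 i * conj (y.1 i)) ^ m) * scalarKernel n l x y)
      = ((1 + m / l : ℝ) : ℂ) * ⟪e, e⟫_ℂ - ⟪T.adjoint e, T.adjoint e⟫_ℂ := by
    rw [h1, h2, Finset.mul_sum, ← Finset.sum_sub_distrib]
    refine Finset.sum_congr rfl fun x _ => ?_
    rw [Finset.mul_sum, ← Finset.sum_sub_distrib]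
    refine Finset.sum_congr rfl fun y _ => ?_
    ring
  have hre : ∀ x : WeightedBergman n l, (⟪x, x⟫_ℂ).re = ‖x‖ ^ 2 := fun x =>
    inner_self_eq_norm_sq (𝕜 := ℂ) x
  rw [h3, Complex.sub_re, Complex.re_ofReal_mul, hre, hre] at h
  refine (sq_le_sq₀ (norm_nonneg _) (by positivity)).1 ?_
  rw [mul_pow]
  nlinarith [sq_nonneg ‖e‖]

/-! ### Holomorphy of the kernel and density of the polynomials -/

/-- The operator `(1 - t Mᵢ) ^ (-l)`, where `Mᵢ` is multiplication by the `i`-th coordinate, defined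
by its binomial series; the value is meaningful for `‖t‖ < 1`, where the series converges. -/
noncomputable def resolventPower (n : ℕ) (l : ℝ) [Fact (0 < l)] (i : Fin n) (t : ℂ) :
    WeightedBergman n l →L[ℂ] WeightedBergman n l :=
  ∑' m : ℕ, ((binomCoeff l m : ℂ) * t ^ m) • mulOp n l (MvPolynomial.X i ^ m)

theorem norm_resolventPower_term_le (i : Fin n) {t : ℂ} {r : ℝ} (ht : ‖t‖ ≤ r) (m : ℕ) :
    ‖((binomCoeff l m : ℂ) * t ^ m) • mulOp n l (MvPolynomial.X i ^ m)‖ ≤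
      binomCoeff (l + 1) m * r ^ m := by
  have hb := binomCoeff_nonneg hl.out m
  rw [norm_smul, norm_mul, norm_pow, Complex.norm_real, Real.norm_of_nonneg hb,
    binomCoeff_succ_param hl.out, mul_right_comm]
  have := norm_mulOp_X_pow_le (l := l) i m
  have h0 : 0 ≤ binomCoeff l m * (1 + m / l) := by
    have := hl.out
    positivity
  gcongr

/-- The binomial series converges absolutely on the unit disc. -/
theorem summable_binomCoeff {l : ℝ} {r : ℝ} (h0 : 0 ≤ r) (h1 : r < 1) :
    Summable fun m => binomCoeff l m * r ^ m := by
  have := (hasSum_binom l (t := r) (by simpa [abs_of_nonneg h0] using h1)).summable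
  exact_mod_cast this

theorem hasSum_resolventPower (i : Fin n) {t : ℂ} (ht : ‖t‖ < 1) :
    HasSum (fun m : ℕ => ((binomCoeff l m : ℂ) * t ^ m) • mulOp n l (MvPolynomial.X i ^ m))
      (resolventPower n l i t) :=
  (Summable.of_norm_bounded (summable_binomCoeff (norm_nonneg t) ht)
    (norm_resolventPower_term_le i le_rfl)).hasSum

theorem differentiableOn_resolventPower (i : Fin n) :
    DifferentiableOn ℂ (resolventPower n l i) (Metric.ball 0 1) := by
  intro t ht
  rw [mem_ball_zero_iff] at ht
  obtain ⟨r, htr, hr⟩ := exists_between ht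
  have h := Complex.differentiableOn_tsum_of_summable_norm
    (summable_binomCoeff (l := l + 1) ((norm_nonneg t).trans htr.le) hr)
    (F := fun m t => ((binomCoeff l m : ℂ) * t ^ m) • mulOp n l (MvPolynomial.X i ^ m))
    (U := Metric.ball 0 r) (fun m => by fun_prop) Metric.isOpen_ball
    (fun m w hw => norm_resolventPower_term_le i (mem_ball_zero_iff.1 hw).le m)
  exact (h.differentiableAt (Metric.isOpen_ball.mem_nhds (by simpa using htr))).differentiableWithinAt

theorem resolventPower_apply (i : Fin n) {t : ℂ} (ht : ‖t‖ < 1) (f : WeightedBergman n l)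
    (z : polydisc n) : resolventPower n l i t f z = (1 - z.1 i * t) ^ (-(l : ℂ)) * f z := by
  have h1 := ((innerSL ℂ (kernelFun n l z)).hasSum
    ((ContinuousLinearMap.apply ℂ (WeightedBergman n l) f).hasSum (hasSum_resolventPower i ht)))
  simp only [ContinuousLinearMap.apply_apply, innerSL_apply_apply, inner_kernelFun,
    smul_apply, inner_smul_right, mulOp_apply, map_pow,
    MvPolynomial.eval_X] at h1
  have hz : ‖z.1 i * t‖ < 1 := by
    rw [norm_mul]
    exact mul_lt_one_of_nonneg_of_lt_one_left (norm_nonneg _) (z.2 i) ht.le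
  refine h1.unique (((hasSum_binom l hz).mul_right (f z)).congr_fun fun m => ?_)
  rw [mul_pow]
  ring

/-- The constant function `1`, which is the kernel function at the centre of the polydisc. -/
noncomputable def oneFun (n : ℕ) (l : ℝ) [Fact (0 < l)] : WeightedBergman n l :=
  kernelFun n l ⟨0, fun _ => by simp⟩

theorem oneFun_apply (z : polydisc n) : oneFun n l z = 1 := by
  simp [oneFun, kernelFun_apply, scalarKernel]

/-- The closure of the polynomials in `𝔸^(λ)(𝔻ⁿ)`. -/
noncomputable def polyClosure (n : ℕ) (l : ℝ) [Fact (0 < l)] : Submodule ℂ (WeightedBergman n l) :=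
  (Submodule.span ℂ (Set.range fun p => mulOp n l p (oneFun n l))).topologicalClosure

theorem mulOp_mem_polyClosure (q : MvPolynomial (Fin n) ℂ) {f : WeightedBergman n l}
    (hf : f ∈ polyClosure n l) : mulOp n l q f ∈ polyClosure n l := by
  refine map_mem_closure (mulOp n l q).continuous hf fun g hg => ?_
  rw [SetLike.mem_coe] at hg ⊢
  induction hg using Submodule.span_induction with
  | mem x hx =>
    obtain ⟨p, rfl⟩ := hx
    refine Submodule.subset_span ⟨q * p, ?_⟩
    exact DFunLike.congr_fun (map_mul (polyAction n l) q p) (oneFun n l)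
  | zero => rw [map_zero]; exact zero_mem _
  | add x y _ _ hx hy => rw [map_add]; exact add_mem hx hy
  | smul a x _ hx => rw [map_smul]; exact Submodule.smul_mem _ a hx

theorem resolventPower_mem_polyClosure (i : Fin n) {t : ℂ} (ht : ‖t‖ < 1)
    {f : WeightedBergman n l} (hf : f ∈ polyClosure n l) :
    resolventPower n l i t f ∈ polyClosure n l := by
  have h := (ContinuousLinearMap.apply ℂ (WeightedBergman n l) f).hasSum
    (hasSum_resolventPower i ht)
  refine (Submodule.isClosed_topologicalClosure _).mem_of_tendsto h
    (Filter.Eventually.of_forall fun s => sum_mem fun m _ => ?_)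
  exact Submodule.smul_mem _ _ (mulOp_mem_polyClosure _ hf)

/-- The functions `∏_{j ∈ s} (1 - zⱼ vⱼ) ^ (-l)` of `z` depend holomorphically on `v` and are limits of
polynomials: they arise from `1` by applying the operators `resolventPower`. -/
theorem exists_holomorphic_partial_kernel (s : Finset (Fin n)) :
    ∃ G : (Fin n → ℂ) → WeightedBergman n l, DifferentiableOn ℂ G (polydisc n) ∧
      ∀ v ∈ polydisc n, G v ∈ polyClosure n l ∧
        ∀ z : polydisc n, G v z = ∏ j ∈ s, (1 - z.1 j * v j) ^ (-(l : ℂ)) := by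
  induction s using Finset.induction_on with
  | empty =>
    refine ⟨fun _ => oneFun n l, differentiableOn_const _, fun v _ => ⟨?_, fun z => ?_⟩⟩
    · refine subset_closure (Submodule.subset_span ⟨1, ?_⟩)
      exact DFunLike.congr_fun (map_one (polyAction n l)) (oneFun n l)
    · rw [oneFun_apply, Finset.prod_empty]
  | insert a s ha ih =>
    obtain ⟨G, hG, hG'⟩ := ih
    refine ⟨fun v => resolventPower n l a (v a) (G v), ?_, fun v hv => ⟨?_, fun z => ?_⟩⟩
    · refine DifferentiableOn.clm_apply ?_ hG
      exact (differentiableOn_resolventPower a).comp (by fun_prop)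
        fun v hv => mem_ball_zero_iff.2 (hv a)
    · exact resolventPower_mem_polyClosure a (hv a) (hG' v hv).1
    · rw [resolventPower_apply a (hv a), (hG' v hv).2, Finset.prod_insert ha]

theorem star_mem_polydisc {v : Fin n → ℂ} (hv : v ∈ polydisc n) : star v ∈ polydisc n :=
  fun j => by simpa using hv j

/-- The kernel function of `w` is a holomorphic function of `conj w`, and a limit of polynomials. -/
theorem exists_holomorphic_kernel :
    ∃ G : (Fin n → ℂ) → WeightedBergman n l, DifferentiableOn ℂ G (polydisc n) ∧
      ∀ w : polydisc n, G (star w.1) = kernelFun n l w ∧ kernelFun n l w ∈ polyClosure n l := by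
  obtain ⟨G, hG, hG'⟩ := exists_holomorphic_partial_kernel (n := n) (l := l) Finset.univ
  refine ⟨G, hG, fun w => ?_⟩
  have hw := hG' _ (star_mem_polydisc w.2)
  have h : G (star w.1) = kernelFun n l w :=
    RKHS.ext fun z => by rw [hw.2, kernelFun_apply]; rfl
  exact ⟨h, h ▸ hw.1⟩

theorem polyClosure_eq_top : polyClosure n l = ⊤ := by
  obtain ⟨G, -, hG⟩ := exists_holomorphic_kernel (n := n) (l := l)
  rw [eq_top_iff, ← closure_span_kernelFun]
  refine Submodule.topologicalClosure_minimal _ (Submodule.span_le.2 ?_)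
    (Submodule.isClosed_topologicalClosure _)
  rintro _ ⟨w, rfl⟩
  exact (hG w).2

/-! ### The module tensor product and its frame -/

theorem inner_kernelFun_mulOp_oneFun (w : polydisc n) (p : MvPolynomial (Fin n) ℂ) :
    ⟪kernelFun n l w, mulOp n l p (oneFun n l)⟫_ℂ = MvPolynomial.eval w.1 p := by
  rw [inner_kernelFun, mulOp_apply, oneFun_apply, mul_one]

/-- Vectors are determined by their inner products with polynomials, as these are dense. -/
theorem ext_inner_polynomial {f g : WeightedBergman n l}
    (h : ∀ p, ⟪f, mulOp n l p (oneFun n l)⟫_ℂ = ⟪g, mulOp n l p (oneFun n l)⟫_ℂ) : f = g := by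
  have hd : Dense (Submodule.span ℂ (Set.range fun p => mulOp n l p (oneFun n l)) :
      Set (WeightedBergman n l)) := by
    rw [Submodule.dense_iff_topologicalClosure_eq_top]
    exact polyClosure_eq_top
  refine ext_inner_right ℂ fun x => ?_
  refine congrFun (Continuous.ext_on (f := fun x => ⟪f, x⟫_ℂ) (g := fun x => ⟪g, x⟫_ℂ)
    hd (by fun_prop) (by fun_prop) fun x hx => ?_) x
  induction hx using Submodule.span_induction with
  | mem x hx =>
    obtain ⟨p, rfl⟩ := hx
    exact h p
  | zero => simp
  | add x y _ _ hx hy => simp only [inner_add_right] at hx hy ⊢; rw [hx, hy]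
  | smul a x _ hx => simp only [inner_smul_right] at hx ⊢; rw [hx]

theorem linearIndependent_kernelFun {ι : Type*} [Fintype ι] {z : ι → polydisc n}
    (hz : Function.Injective z) : LinearIndependent ℂ fun i => kernelFun n l (z i) := by
  classical
  rw [Fintype.linearIndependent_iff]
  intro c hc i
  obtain ⟨p, hp⟩ := exists_eval_eq_ite (Subtype.val_injective.comp hz) i
  have h := congrArg (fun f => ⟪f, mulOp n l p (oneFun n l)⟫_ℂ) hc
  simp only [sum_inner, inner_smul_left, inner_kernelFun_mulOp_oneFun, inner_zero_left] at h
  simp only [Function.comp_apply] at hp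
  simpa [hp] using h

/-- The module tensor product is the joint eigenspace of the adjoints of the action. -/
theorem mem_moduleTensor_iff {u : Fin n → ℂ} {g : WeightedBergman n l} :
    g ∈ moduleTensor (symAction n l) (symEval n u) ↔
      ∀ p f, ⟪symAction n l p f, g⟫_ℂ = conj (symEval n u p) * ⟪f, g⟫_ℂ := by
  rw [moduleTensor, tensorRelations, Submodule.orthogonal_closure, Submodule.mem_orthogonal]
  constructor
  · intro h p f
    have := h _ (Submodule.subset_span ⟨p, f, rfl⟩)
    rwa [inner_sub_left, inner_smul_left, sub_eq_zero] at this
  · intro h x hx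
    induction hx using Submodule.span_induction with
    | mem x hx =>
      obtain ⟨p, f, rfl⟩ := hx
      rw [inner_sub_left, inner_smul_left, h, sub_self]
    | zero => simp
    | add x y _ _ hx hy => rw [inner_add_left, hx, hy, add_zero]
    | smul a x _ hx => rw [inner_smul_left, hx, mul_zero]

theorem kernelFun_mem_moduleTensor (w : polydisc n) :
    kernelFun n l w ∈ moduleTensor (symAction n l) (symEval n (symmetrization n w.1)) := by
  refine mem_moduleTensor_iff.2 fun p f => ?_
  rw [← inner_conj_symm, inner_kernelFun, symAction_apply, symEval_symmetrization, map_mul,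
    ← inner_kernelFun, inner_conj_symm]

/-- The kernel functions of the points of the fibre span the module tensor product. -/
theorem moduleTensor_le_span_kernelFun {ι : Type*} [Fintype ι] {w : Fin n → ℂ}
    (hw : Function.Injective w) {z : ι → polydisc n} (hz : Function.Injective z)
    (hfib : ∀ a, symmetrization n a = symmetrization n w → ∃ i, (z i).1 = a) :
    moduleTensor (symAction n l) (symEval n (symmetrization n w)) ≤
      Submodule.span ℂ (Set.range fun i => kernelFun n l (z i)) := by
  classical
  intro g hg
  rw [mem_moduleTensor_iff] at hg
  have hinj : Function.Injective fun i => (z i).1 := Subtype.val_injective.comp hz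
  choose L hL using fun i => exists_eval_eq_ite hinj i
  let ℓ : MvPolynomial (Fin n) ℂ →ₗ[ℂ] ℂ :=
    { toFun := fun p => ⟪g, polyAction n l p (oneFun n l)⟫_ℂ
      map_add' := fun p q => by simp [inner_add_right]
      map_smul' := fun a p => by simp [inner_smul_right] }
  have hℓ : ∀ q : MvPolynomial (Fin n) ℂ, q.IsSymmetric → ∀ p,
      ℓ (q * p) = MvPolynomial.eval w q * ℓ p := by
    intro q hq p
    have h := hg ⟨q, hq⟩ (polyAction n l p (oneFun n l))
    rw [symEval_symmetrization] at h
    have h' := congrArg conj h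
    rw [map_mul, inner_conj_symm, inner_conj_symm, Complex.conj_conj] at h'
    change ⟪g, polyAction n l (q * p) (oneFun n l)⟫_ℂ = _
    rw [map_mul]
    exact h'
  have hg_eq : g = ∑ i, conj (ℓ (L i)) • kernelFun n l (z i) := by
    refine ext_inner_polynomial fun p => ?_
    have h0 := apply_eq_zero_of_eval_fibre_eq_zero hw ℓ hℓ
      (p - ∑ i, MvPolynomial.eval (z i).1 p • L i) fun a ha => by
        obtain ⟨i, rfl⟩ := hfib a ha
        simp [MvPolynomial.smul_eval, hL]
    rw [map_sub, sub_eq_zero] at h0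
    simp only [sum_inner, inner_smul_left, inner_kernelFun_mulOp_oneFun, Complex.conj_conj]
    refine h0.trans ?_
    simp [mul_comm]
  rw [hg_eq]
  exact sum_mem fun i _ => Submodule.smul_mem _ _ (Submodule.subset_span ⟨i, rfl⟩)

theorem injective_of_mem_regularSet {w : Fin n → ℂ} (hw : w ∈ polydisc n)
    (h : symmetrization n w ∈ regularSet n) : Function.Injective w := by
  intro i j hij
  by_contra hne
  exact h.2 ⟨w, ⟨hw, i, j, hne, hij⟩, rfl⟩

/-- Conjugating both the argument and the values of a holomorphic map gives a holomorphic map. -/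
theorem differentiableOn_star_comp_star {f : (Fin n → ℂ) → Fin n → ℂ} {U : Set (Fin n → ℂ)}
    (hUo : IsOpen U) (hf : DifferentiableOn ℂ f U) :
    DifferentiableOn ℂ (fun v => star (f (star v))) (conjSet U) := fun v hv =>
  (by simpa [Function.comp_def] using
    DifferentiableAt.star_star ((hf (star v) hv).differentiableAt (hUo.mem_nhds hv)) :
    DifferentiableAt ℂ (fun v => star (f (star v))) v).differentiableWithinAt

theorem isHolomorphicFrame_kernelFun {U : Set (Fin n → ℂ)}
    {φ : Fin n.factorial → (Fin n → ℂ) → polydisc n} (hUo : IsOpen U) (hU : U ⊆ regularSet n)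
    (hφ : IsLocalInverses n U φ) :
    IsHolomorphicFrame (symAction n l) (symEval n) (conjSet U)
      (fun i v => kernelFun n l (φ i (star v))) where
  holomorphic i := by
    obtain ⟨G, hG, hGk⟩ := exists_holomorphic_kernel (n := n) (l := l)
    refine (hG.comp (differentiableOn_star_comp_star hUo (hφ.holomorphic i))
      fun v _ => star_mem_polydisc (φ i (star v)).2).congr fun v _ => ?_
    exact (hGk _).1.symm
  linearIndependent v hv := linearIndependent_kernelFun (hφ.injective _ hv)
  span_eq v hv := by
    refine le_antisymm (Submodule.span_le.2 ?_) ?_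
    · rintro _ ⟨i, rfl⟩
      have := kernelFun_mem_moduleTensor (l := l) (φ i (star v))
      rwa [hφ.symmetrization_eq i _ hv] at this
    · obtain ⟨w, hw, hwu⟩ := (hU hv).1
      have hinj : Function.Injective w := injective_of_mem_regularSet hw (hwu ▸ hU hv)
      have h := moduleTensor_le_span_kernelFun (l := l) hinj (hφ.injective _ hv) fun a ha => by
        obtain ⟨σ, rfl⟩ := exists_perm_of_symmetrization_eq hinj ha
        obtain ⟨i, hi⟩ := hφ.exhaust _ hv ⟨w ∘ σ, fun j => hw (σ j)⟩ (ha.trans hwu)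
        exact ⟨i, congrArg Subtype.val hi⟩
      rwa [hwu] at h

/-! ### Local inverses of the symmetrization map -/

theorem contDiff_symmetrization {k : WithTop ℕ∞} : ContDiff ℂ k (symmetrization n) := by
  refine contDiff_pi.2 fun j => ?_
  simp only [symmetrization, MvPolynomial.esymm, map_sum, map_prod, MvPolynomial.eval_X]
  fun_prop

/-- Vieta's formula expresses `z ↦ ∏ⱼ (wᵢ - zⱼ)` through `symmetrization`; its derivative at `w` is
`h ↦ -hᵢ ∏_{j ≠ i} (wᵢ - wⱼ)`, so `h` vanishes when the derivative of `symmetrization` kills it. -/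
theorem fderiv_symmetrization_injective {w : Fin n → ℂ} (hw : Function.Injective w) :
    Function.Injective (fderiv ℂ (symmetrization n) w) := by
  rw [injective_iff_map_eq_zero]
  intro h hh
  funext i
  have hs : HasFDerivAt (symmetrization n) (fderiv ℂ (symmetrization n) w) w :=
    (contDiff_symmetrization.differentiable one_ne_zero w).hasFDerivAt
  have h1 : HasFDerivAt (fun z : Fin n → ℂ => ∏ j, (w i - z j)) _ w :=
    HasFDerivAt.finsetProd (u := Finset.univ) (x := w) fun j _ =>
      (hasFDerivAt_apply (𝕜 := ℂ) j w).const_sub (w i)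
  have h2 : HasFDerivAt (fun z : Fin n → ℂ => ∏ j, (w i - z j))
      (∑ k : Fin n, ((-1) ^ ((k : ℕ) + 1) * w i ^ (n - 1 - k)) •
        (ContinuousLinearMap.proj k).comp (fderiv ℂ (symmetrization n) w)) w := by
    have := HasFDerivAt.fun_sum (u := Finset.univ) fun (k : Fin n) _ =>
      ((hasFDerivAt_pi'.1 hs k).const_mul ((-1 : ℂ) ^ ((k : ℕ) + 1) * w i ^ (n - 1 - k)))
    refine (this.const_add (w i ^ n)).congr_of_eventuallyEq (Filter.Eventually.of_forall fun z => ?_)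
    simp only [prod_sub_eq_sum_symmetrization]
    congr 1
    exact Finset.sum_congr rfl fun k _ => by ring
  have h3 := DFunLike.congr_fun (h1.unique h2) h
  simp only [sum_apply, smul_apply, neg_apply, ContinuousLinearMap.proj_apply,
    ContinuousLinearMap.comp_apply, hh, Pi.zero_apply, smul_zero, Finset.sum_const_zero] at h3
  rw [Finset.sum_eq_single i] at h3
  · refine neg_eq_zero.1 ((smul_eq_zero.1 h3).resolve_left ?_)
    refine Finset.prod_ne_zero_iff.2 ?_
    intro j hj
    exact sub_ne_zero.2 (hw.ne (Finset.ne_of_mem_erase hj).symm)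
  · intro j _ hj
    rw [Finset.prod_eq_zero (Finset.mem_erase.2 ⟨hj.symm, Finset.mem_univ i⟩) (sub_self _),
      zero_smul]
  · simp

theorem isOpen_polydisc : IsOpen (polydisc n) := by
  simp only [polydisc, Set.ofPred_forall]
  exact isOpen_iInter_of_finite fun j => isOpen_lt (by fun_prop) continuous_const

theorem isOpen_setOf_injective : IsOpen {z : Fin n → ℂ | Function.Injective z} := by
  simp only [Function.Injective, Set.ofPred_forall]
  refine isOpen_iInter_of_finite fun i => isOpen_iInter_of_finite fun j => ?_
  by_cases hij : i = j
  · simp [hij]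
  · simpa [hij] using isOpen_ne_fun (continuous_apply (A := fun _ : Fin n => ℂ) i) (continuous_apply j)

theorem symmetrization_mem_regularSet {w : Fin n → ℂ} (hw : w ∈ polydisc n)
    (hinj : Function.Injective w) : symmetrization n w ∈ regularSet n := by
  refine ⟨⟨w, hw, rfl⟩, ?_⟩
  rintro ⟨z, ⟨-, i, j, hij, hz⟩, hzw⟩
  obtain ⟨σ, rfl⟩ := exists_perm_of_symmetrization_eq hinj hzw
  exact hij (σ.injective (hinj hz))

theorem regularSet_eq_image : regularSet n =
    symmetrization n '' (polydisc n ∩ {z | Function.Injective z}) := by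
  ext u
  constructor
  · intro hu
    obtain ⟨w, hw, rfl⟩ := hu.1
    exact ⟨w, ⟨hw, injective_of_mem_regularSet hw hu⟩, rfl⟩
  · rintro ⟨w, ⟨hw, hinj⟩, rfl⟩
    exact symmetrization_mem_regularSet hw hinj

/-- The local inverse of `symmetrization` near a point with distinct coordinates. -/
theorem exists_local_section {w : Fin n → ℂ} (hw : w ∈ polydisc n) (hinj : Function.Injective w) :
    ∃ (U : Set (Fin n → ℂ)) (ψ : (Fin n → ℂ) → Fin n → ℂ), IsOpen U ∧ symmetrization n w ∈ U ∧
      DifferentiableOn ℂ ψ U ∧ ∀ u ∈ U, ψ u ∈ polydisc n ∧ Function.Injective (ψ u) ∧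
        symmetrization n (ψ u) = u := by
  have hcd : ContDiffAt ℂ 1 (symmetrization n) w := contDiff_symmetrization.contDiffAt
  let L : (Fin n → ℂ) ≃L[ℂ] (Fin n → ℂ) := (LinearEquiv.ofInjectiveEndo
    (fderiv ℂ (symmetrization n) w : (Fin n → ℂ) →ₗ[ℂ] (Fin n → ℂ))
    (fderiv_symmetrization_injective hinj)).toContinuousLinearEquiv
  have hL : HasFDerivAt (symmetrization n) (L : (Fin n → ℂ) →L[ℂ] (Fin n → ℂ)) w := by
    convert! (contDiff_symmetrization.differentiable one_ne_zero w).hasFDerivAt using 1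
  let ψ := hcd.localInverse hL one_ne_zero
  have hψw : ψ (symmetrization n w) = w := hcd.localInverse_apply_image hL one_ne_zero
  have hψ : ContDiffAt ℂ 1 ψ (symmetrization n w) := hcd.to_localInverse hL one_ne_zero
  have h1 : ∀ᶠ u in nhds (symmetrization n w), DifferentiableAt ℂ ψ u :=
    (hψ.eventually (by simp)).mono fun u hu => hu.differentiableAt one_ne_zero
  have h2 : ∀ᶠ u in nhds (symmetrization n w), symmetrization n (ψ u) = u :=
    (hcd.hasStrictFDerivAt' hL one_ne_zero).eventually_right_inverse
  have h3 : ∀ᶠ u in nhds (symmetrization n w), ψ u ∈ polydisc n ∩ {z | Function.Injective z} :=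
    hψ.continuousAt.eventually_mem
      ((isOpen_polydisc.inter isOpen_setOf_injective).mem_nhds (by rw [hψw]; exact ⟨hw, hinj⟩))
  obtain ⟨U, hU, hUo, hwU⟩ := eventually_nhds_iff.1 (h1.and (h2.and h3))
  exact ⟨U, ψ, hUo, hwU, fun u hu => (hU u hu).1.differentiableWithinAt,
    fun u hu => ⟨(hU u hu).2.2.1, (hU u hu).2.2.2, (hU u hu).2.1⟩⟩

theorem exists_isLocalInverses {u₀ : Fin n → ℂ} (hu₀ : u₀ ∈ regularSet n) :
    ∃ (U : Set (Fin n → ℂ)) (φ : Fin n.factorial → (Fin n → ℂ) → polydisc n),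
      IsOpen U ∧ u₀ ∈ U ∧ U ⊆ regularSet n ∧ IsLocalInverses n U φ := by
  classical
  rw [regularSet_eq_image] at hu₀
  obtain ⟨w, ⟨hw, hinj⟩, rfl⟩ := hu₀
  obtain ⟨U, ψ, hUo, hwU, hψ, hU⟩ := exists_local_section hw hinj
  let e : Fin n.factorial ≃ Equiv.Perm (Fin n) :=
    (Fintype.equivFinOfCardEq (by rw [Fintype.card_perm, Fintype.card_fin])).symm
  -- Outside `U` the value is irrelevant; `w` serves as a default.
  let φ : Fin n.factorial → (Fin n → ℂ) → polydisc n := fun i u =>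
    if h : ψ u ∈ polydisc n then ⟨ψ u ∘ e i, fun j => h (e i j)⟩ else ⟨w, hw⟩
  have hφ : ∀ i, ∀ u ∈ U, (φ i u).1 = ψ u ∘ e i := fun i u hu => by
    simp only [φ, dif_pos (hU u hu).1]
  refine ⟨U, φ, hUo, hwU, fun u hu => ?_, ⟨fun i => ?_, fun i u hu => ?_, fun u hu i j hij => ?_,
    fun u hu z hz => ?_⟩⟩
  · rw [← (hU u hu).2.2]
    exact symmetrization_mem_regularSet (hU u hu).1 (hU u hu).2.1
  · refine DifferentiableOn.congr ?_ (hφ i)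
    exact differentiableOn_pi.2 fun j => differentiableOn_pi.1 hψ (e i j)
  · rw [hφ i u hu, symmetrization_comp_perm, (hU u hu).2.2]
  · have h := congrArg Subtype.val hij
    simp only [hφ _ u hu] at h
    exact e.injective (Equiv.ext fun k => (hU u hu).2.1 (congrFun h k))
  · obtain ⟨σ, hσ⟩ := exists_perm_of_symmetrization_eq (hU u hu).2.1 (hz.trans (hU u hu).2.2.symm)
    exact ⟨e.symm σ, Subtype.ext (by rw [hφ _ u hu, e.apply_symm_apply, hσ])⟩

/-! ### Topology of the regular set -/

theorem isOpen_regularSet : IsOpen (regularSet n) := by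
  refine isOpen_iff_forall_mem_open.2 fun u hu => ?_
  obtain ⟨U, -, hUo, huU, hU, -⟩ := exists_isLocalInverses hu
  exact ⟨U, hU, hUo, huU⟩

theorem isBounded_regularSet : Bornology.IsBounded (regularSet n) := by
  have h1 : IsCompact (symmetrization n '' Metric.closedBall 0 1) :=
    (isCompact_closedBall _ _).image (contDiff_symmetrization (k := 0)).continuous
  refine h1.isBounded.subset (Set.sdiff_subset.trans (Set.image_mono fun z hz => ?_))
  exact mem_closedBall_zero_iff.2 ((pi_norm_le_iff_of_nonneg zero_le_one).2 fun j => (hz j).le)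

/-- Two points with distinct coordinates are joined within such points by the complex line through
them with countably many parameters removed. -/
theorem isConnected_setOf_injective : IsConnected {z : Fin n → ℂ | Function.Injective z} := by
  refine ⟨⟨fun i => (i : ℂ), fun i j h => Fin.ext (Nat.cast_injective h)⟩, ?_⟩
  refine isPreconnected_of_forall_pair fun a ha b hb => ?_
  let f : ℂ → Fin n → ℂ := fun t i => a i + t * (b i - a i)
  let B : Set ℂ := ⋃ i, ⋃ j, {t | i ≠ j ∧ f t i = f t j}
  have hB : B.Countable := by
    refine Set.countable_iUnion fun i => Set.countable_iUnion fun j =>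
      Set.Subsingleton.countable fun s hs t ht => ?_
    have hij : a i - a j ≠ 0 := sub_ne_zero.2 (ha.ne hs.1)
    have h1 : a i + s * (b i - a i) = a j + s * (b j - a j) := hs.2
    have h2 : a i + t * (b i - a i) = a j + t * (b j - a j) := ht.2
    refine mul_left_cancel₀ hij ?_
    linear_combination s * h2 - t * h1
  have hc : IsConnected Bᶜ := hB.isConnected_compl_of_one_lt_rank (by simp)
  have hf : Bᶜ = f ⁻¹' {z | Function.Injective z} := by
    ext t
    simp only [B, Set.mem_compl_iff, Set.mem_iUnion, Set.mem_ofPred_eq, Set.mem_preimage]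
    push Not
    exact ⟨fun h i j hij => by_contra fun hne => h i j hne hij, fun h i j hij => h.ne hij⟩
  have hf0 : f 0 = a := by funext i; simp [f]
  have hf1 : f 1 = b := by funext i; simp [f]
  refine ⟨f '' Bᶜ, ?_, ⟨0, ?_, hf0⟩, ⟨1, ?_, hf1⟩, ?_⟩
  · rw [hf]; exact Set.image_preimage_subset _ _
  · rw [hf, Set.mem_preimage, hf0]; exact ha
  · rw [hf, Set.mem_preimage, hf1]; exact hb
  · exact hc.isPreconnected.image f (by fun_prop)

/-- Applying the homeomorphism of `ℂ` with the unit disc to each coordinate identifies the points of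
`ℂⁿ` with distinct coordinates with those of the polydisc. -/
theorem isConnected_regularSet : IsConnected (regularSet n) := by
  let e : ℂ ≃ₜ Metric.ball (0 : ℂ) 1 := Homeomorph.unitBall
  have h := (isConnected_setOf_injective (n := n)).image (fun z j => (e (z j) : ℂ))
    (Continuous.continuousOn (by fun_prop))
  rw [regularSet_eq_image]
  convert! h.image _ (contDiff_symmetrization (n := n) (k := 0)).continuous.continuousOn using 2
  ext z
  constructor
  · rintro ⟨hz, hinj⟩
    have hz' : ∀ j, z j ∈ Metric.ball (0 : ℂ) 1 := fun j => mem_ball_zero_iff.2 (hz j)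
    refine ⟨fun j => e.symm ⟨z j, hz' j⟩, fun i j hij => ?_, funext fun j => ?_⟩
    · exact hinj (congrArg Subtype.val (e.symm.injective hij))
    · exact congrArg Subtype.val (e.apply_symm_apply _)
  · rintro ⟨y, hy, rfl⟩
    exact ⟨fun j => mem_ball_zero_iff.1 (e (y j)).2,
      fun i j hij => hy (e.injective (Subtype.ext hij))⟩

theorem isOpen_conjSet {U : Set (Fin n → ℂ)} (hU : IsOpen U) : IsOpen (conjSet U) :=
  hU.preimage continuous_star

end BergmanModule

theorem theorem2p3 (n : ℕ) (lam : ℝ) [Fact (0 < lam)] :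
    BergmanModule.IsLocallyFreeOn (BergmanModule.symAction n lam) (BergmanModule.symEval n)
      (BergmanModule.regularSet n) n.factorial ∧
    (∀ u₀ ∈ BergmanModule.regularSet n,
      ∃ (U : Set (Fin n → ℂ)) (φ : Fin n.factorial → (Fin n → ℂ) → BergmanModule.polydisc n),
        IsOpen U ∧ u₀ ∈ U ∧ U ⊆ BergmanModule.regularSet n ∧
          BergmanModule.IsLocalInverses n U φ) ∧
    (∀ (U : Set (Fin n → ℂ)) (φ : Fin n.factorial → (Fin n → ℂ) → BergmanModule.polydisc n),
      IsOpen U → U ⊆ BergmanModule.regularSet n → BergmanModule.IsLocalInverses n U φ →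
        BergmanModule.IsHolomorphicFrame (BergmanModule.symAction n lam) (BergmanModule.symEval n)
          (BergmanModule.conjSet U)
          (fun i v => BergmanModule.kernelFun n lam (φ i (star v)))) := by
  refine ⟨⟨BergmanModule.isBounded_regularSet, BergmanModule.isOpen_regularSet,
    BergmanModule.isConnected_regularSet, fun w hw => ?_⟩,
    fun u₀ hu₀ => BergmanModule.exists_isLocalInverses hu₀,
    fun U φ hUo hU hφ => BergmanModule.isHolomorphicFrame_kernelFun hUo hU hφ⟩
  obtain ⟨U, φ, hUo, hwU, hU, hφ⟩ := BergmanModule.exists_isLocalInverses hw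
  exact ⟨BergmanModule.conjSet U, BergmanModule.isOpen_conjSet hUo, hwU, fun v hv => hU hv, _,
    BergmanModule.isHolomorphicFrame_kernelFun hUo hU hφ⟩
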